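/- Let $\mathbb C\langle\langle A,B\rangle\rangle$ and $\mathbb C\langle\langle A,b_0,b_1\rangle\rangle$ be the algebras of formal power series over $\mathbb C$ in free noncommuting variables. Derivatives and limits of functions with values in these algebras are taken coefficientwise. For a real number $a>0$ and a series $x$ without constant term put $a^x:=\exp(x\ln a)$. The KZ associator is $\Phi(A,B):=G_1^{-1}G_0\in\mathbb C\langle\langle A,B\rangle\rangle$, where $G_0,G_1$ are the solutions on $(0,1)$, with invertible values, of $$(dG)\,G^{-1}=\Big(\frac{A}{u}+\frac{B}{u-1}\Big)du$$ such that $G_0(u)\simeq u^A$ as $u\to0^+$ and $G_1(u)\simeq(1-u)^B$ as $u\to1^-$, i.e. $G_0(u)u^{-A}\to1$ as $u\to 0^+$ and $G_1(u)(1-u)^{-B}\to1$ as $u\to 1^-$. Similarly $\Psi_2(A|b_0,b_1):=H_1^{-1}H_0\in\mathbb C\langle\langle A,b_0,b_1\rangle\rangle$, where $H_0,H_1$ are the solutions on $(0,1)$, with invertible values, of $$(dH)\,H^{-1}=\Big(\frac{A}{z}+\frac{b_0}{z-1}+\frac{b_1}{z+1}\Big)dz$$ such that $H_0(z)\simeq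 z^A$ as $z\to0^+$ and $H_1(z)\simeq(1-z)^{b_0}$ as $z\to1^-$, in the same sense. Proposition. The series $\Phi(A,B)$ and $\Psi_2(A|b_0,b_1)$ are well defined (exist and are unique), and in $\mathbb C\langle\langle A,B\rangle\rangle$ one has $$\Phi(A,B)=4^B\,\Psi_2\big(A\,|\,2B,-2(A+B)\big)\,4^A,$$ where $\Psi_2(A|2B,-2(A+B))$ is the image of $\Psi_2(A|b_0,b_1)$ under the substitution $A\mapsto A$, $b_0\mapsto2B$, $b_1\mapsto-2(A+B)$. -/

import Mathlib

open Filter Topology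

noncomputable section

/-- Formal power series over `ℂ` in noncommuting variables indexed by `X`: a series is the family
of its coefficients, indexed by the words in `X`. -/
@[ext]
structure NCSeries (X : Type*) where
  /-- The coefficient of a word. -/
  coeff : List X → ℂ

namespace NCSeries

variable {X Y : Type*}

instance : Zero (NCSeries X) := ⟨⟨fun _ => 0⟩⟩
instance : One (NCSeries X) := ⟨⟨fun w => if w.length = 0 then 1 else 0⟩⟩
instance : Add (NCSeries X) := ⟨fun f g => ⟨fun w => f.coeff w + g.coeff w⟩⟩
instance : Neg (NCSeries X) := ⟨fun f => ⟨fun w => -f.coeff w⟩⟩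
instance : SMul ℂ (NCSeries X) := ⟨fun c f => ⟨fun w => c * f.coeff w⟩⟩

/-- The product: the coefficient of `w` in `f * g` is the sum of `f u * g v` over all the ways
to write the word `w` as a concatenation `u v`. -/
instance : Mul (NCSeries X) :=
  ⟨fun f g => ⟨fun w =>
    ∑ i ∈ Finset.range (w.length + 1), f.coeff (w.take i) * g.coeff (w.drop i)⟩⟩

theorem coeff_zero (w : List X) : (0 : NCSeries X).coeff w = 0 := rfl

theorem coeff_one (w : List X) :
    (1 : NCSeries X).coeff w = if w.length = 0 then 1 else 0 := rfl

theorem coeff_add (f g : NCSeries X) (w : List X) :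
    (f + g).coeff w = f.coeff w + g.coeff w := rfl

theorem coeff_neg (f : NCSeries X) (w : List X) : (-f).coeff w = -f.coeff w := rfl

theorem coeff_smul (c : ℂ) (f : NCSeries X) (w : List X) :
    (c • f).coeff w = c * f.coeff w := rfl

theorem coeff_mul (f g : NCSeries X) (w : List X) :
    (f * g).coeff w =
      ∑ i ∈ Finset.range (w.length + 1), f.coeff (w.take i) * g.coeff (w.drop i) := rfl

theorem coeff_mul_nil (f g : NCSeries X) : (f * g).coeff [] = f.coeff [] * g.coeff [] := by
  simp [coeff_mul]

theorem coeff_mul_cons (f g : NCSeries X) (x : X) (w : List X) :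
    (f * g).coeff (x :: w) =
      f.coeff [] * g.coeff (x :: w) + ((⟨fun v => f.coeff (x :: v)⟩ : NCSeries X) * g).coeff w := by
  rw [coeff_mul, coeff_mul, List.length_cons, Finset.sum_range_succ', add_comm]
  simp

theorem add_mul' (f g h : NCSeries X) : (f + g) * h = f * h + g * h := by
  ext w
  simp only [coeff_mul, coeff_add, add_mul, Finset.sum_add_distrib]

theorem mul_add' (f g h : NCSeries X) : f * (g + h) = f * g + f * h := by
  ext w
  simp only [coeff_mul, coeff_add, mul_add, Finset.sum_add_distrib]

theorem smul_mul' (c : ℂ) (f g : NCSeries X) : (c • f) * g = c • (f * g) := by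
  ext w
  simp only [coeff_mul, coeff_smul, Finset.mul_sum, mul_assoc]

theorem mul_smul' (c : ℂ) (f g : NCSeries X) : f * (c • g) = c • (f * g) := by
  ext w
  simp only [coeff_mul, coeff_smul, Finset.mul_sum, mul_left_comm]

theorem zero_mul' (f : NCSeries X) : 0 * f = 0 := by
  ext w
  simp [coeff_mul, coeff_zero]

theorem mul_zero' (f : NCSeries X) : f * 0 = 0 := by
  ext w
  simp [coeff_mul, coeff_zero]

theorem one_mul' (f : NCSeries X) : 1 * f = f := by
  ext w
  cases w with
  | nil => simp [coeff_mul_nil, coeff_one]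
  | cons x w =>
    have h : (⟨fun v => (1 : NCSeries X).coeff (x :: v)⟩ : NCSeries X) = 0 := by
      ext v
      simp [coeff_one, coeff_zero]
    rw [coeff_mul_cons, h, zero_mul']
    simp [coeff_one, coeff_zero]

theorem mul_one' (f : NCSeries X) : f * 1 = f := by
  ext w
  induction w generalizing f with
  | nil => simp [coeff_mul_nil, coeff_one]
  | cons x w ih =>
    rw [coeff_mul_cons, ih]
    simp [coeff_one]

theorem mul_assoc' (f g h : NCSeries X) : f * g * h = f * (g * h) := by
  ext w
  induction w generalizing f with
  | nil => simp only [coeff_mul_nil, mul_assoc]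
  | cons x w ih =>
    have e : (⟨fun v => (f * g).coeff (x :: v)⟩ : NCSeries X) =
        f.coeff [] • (⟨fun v => g.coeff (x :: v)⟩ : NCSeries X) +
          (⟨fun v => f.coeff (x :: v)⟩ : NCSeries X) * g := by
      ext v
      exact coeff_mul_cons f g x v
    rw [coeff_mul_cons, e, add_mul', smul_mul', coeff_add, coeff_smul, ih, coeff_mul_cons f,
      coeff_mul_cons g, coeff_mul_nil]
    ring

instance : Ring (NCSeries X) where
  add_assoc f g h := by ext w; exact add_assoc _ _ _
  zero_add f := by ext w; exact zero_add _
  add_zero f := by ext w; exact add_zero _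
  add_comm f g := by ext w; exact add_comm _ _
  neg_add_cancel f := by ext w; exact neg_add_cancel _
  nsmul := nsmulRec
  zsmul := zsmulRec
  left_distrib := mul_add'
  right_distrib := add_mul'
  zero_mul := zero_mul'
  mul_zero := mul_zero'
  mul_assoc := mul_assoc'
  one_mul := one_mul'
  mul_one := mul_one'

instance : Module ℂ (NCSeries X) where
  one_smul f := by ext w; exact one_mul _
  mul_smul c d f := by ext w; exact mul_assoc _ _ _
  smul_zero c := by ext w; exact mul_zero _
  smul_add c f g := by ext w; exact mul_add _ _ _
  add_smul c d f := by ext w; exact add_mul _ _ _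
  zero_smul f := by ext w; exact zero_mul _

instance : Algebra ℂ (NCSeries X) := Algebra.ofModule smul_mul' mul_smul'

open Classical in
/-- The variable `x`, as a series. -/
def var (x : X) : NCSeries X := ⟨fun w => if w = [x] then 1 else 0⟩

/-- The exponential `∑ fᵏ / k!`, the sum being taken coefficient by coefficient. -/
def exp (f : NCSeries X) : NCSeries X :=
  ⟨fun w => ∑' k : ℕ, ((k.factorial : ℂ))⁻¹ * (f ^ k).coeff w⟩

/-- The power `a ^ f = exp (f ln a)`, for a positive real number `a`. -/
def rpow (a : ℝ) (f : NCSeries X) : NCSeries X := exp ((Real.log a : ℂ) • f)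

/-- Substitution `f(s)` of series `s x` for the variables `x` in `f`: the sum of
`f.coeff v * s v₁ * s v₂ * ⋯` over the words `v = v₁ v₂ ⋯`, taken coefficient by coefficient.
If the set of variables is finite and the series `s x` have no constant term, then only finitely
many words contribute to each coefficient. -/
def subst (s : X → NCSeries Y) (f : NCSeries X) : NCSeries Y :=
  ⟨fun w => ∑ᶠ v : List X, f.coeff v * ((v.map s).prod).coeff w⟩

/-- The family `F` tends to `L` along the filter `l`, coefficient by coefficient. -/
def TendsTo {T : Type*} (F : T → NCSeries X) (l : Filter T) (L : NCSeries X) : Prop :=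
  ∀ w : List X, Tendsto (fun t => (F t).coeff w) l (𝓝 (L.coeff w))

/-- The function `F` of a real variable has derivative `D` at `z`, coefficient by coefficient. -/
def HasDeriv (F : ℝ → NCSeries X) (D : NCSeries X) (z : ℝ) : Prop :=
  ∀ w : List X, HasDerivAt (fun t => (F t).coeff w) (D.coeff w) z

/-- `G` is a solution on the interval `(0,1)` of `(dG) G⁻¹ = Ω(z) dz`, with invertible values. -/
def IsSolution (Ω : ℝ → NCSeries X) (G : ℝ → (NCSeries X)ˣ) : Prop :=
  ∀ z ∈ Set.Ioo (0 : ℝ) 1, HasDeriv (fun t => (G t : NCSeries X)) (Ω z * (G z : NCSeries X)) z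

/-- `Φ` is the renormalized holonomy from `0` to `1` of `(dG) G⁻¹ = Ω(z) dz`, where `Ω` has residue
`a` at `0` and `b` at `1`: one has `Φ = G₁⁻¹ G₀` on `(0,1)`, where `G₀, G₁` are the solutions
on `(0,1)` such that `G₀(z) ≃ z ^ a` as `z → 0⁺` (that is, `G₀(z) z ^ (-a) → 1`) and
`G₁(z) ≃ (1 - z) ^ b` as `z → 1⁻` (that is, `G₁(z) (1 - z) ^ (-b) → 1`). -/
def IsRenormalizedHolonomy (Ω : ℝ → NCSeries X) (a b Φ : NCSeries X) : Prop :=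
  ∃ G₀ G₁ : ℝ → (NCSeries X)ˣ,
    IsSolution Ω G₀ ∧ IsSolution Ω G₁ ∧
    TendsTo (fun z : ℝ => (G₀ z : NCSeries X) * rpow z (-a)) (𝓝[>] (0 : ℝ)) 1 ∧
    TendsTo (fun z : ℝ => (G₁ z : NCSeries X) * rpow (1 - z) (-b)) (𝓝[<] (1 : ℝ)) 1 ∧
    ∀ z ∈ Set.Ioo (0 : ℝ) 1, Φ = ((G₁ z)⁻¹ : (NCSeries X)ˣ) * (G₀ z : NCSeries X)

end NCSeries

/-- The two free variables `A, B` of the KZ equation. -/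
inductive KZVar
  | A
  | B

/-- The three free variables `A, b₀, b₁` of the equation with poles at `0, 1, -1`. -/
inductive Psi2Var
  | A
  | b₀
  | b₁

/-- `Φ` is the KZ associator `Φ(A,B)`: the renormalized holonomy from `0` to `1` of
`(dG) G⁻¹ = (A / u + B / (u - 1)) du`. -/
def IsKZAssociator (Φ : NCSeries KZVar) : Prop :=
  NCSeries.IsRenormalizedHolonomy
    (fun u : ℝ => ((u : ℂ)⁻¹) • NCSeries.var KZVar.A + (((u : ℂ) - 1)⁻¹) • NCSeries.var KZVar.B)
    (NCSeries.var KZVar.A) (NCSeries.var KZVar.B) Φ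

/-- `Ψ` is the generalized associator `Ψ₂(A|b₀,b₁)`: the renormalized holonomy from `0` to `1` of
`(dH) H⁻¹ = (A / z + b₀ / (z - 1) + b₁ / (z + 1)) dz`. -/
def IsPsi2 (Ψ : NCSeries Psi2Var) : Prop :=
  NCSeries.IsRenormalizedHolonomy
    (fun z : ℝ => ((z : ℂ)⁻¹) • NCSeries.var Psi2Var.A
      + (((z : ℂ) - 1)⁻¹) • NCSeries.var Psi2Var.b₀
      + (((z : ℂ) + 1)⁻¹) • NCSeries.var Psi2Var.b₁)
    (NCSeries.var Psi2Var.A) (NCSeries.var Psi2Var.b₀) Ψ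

/-- The series `Ψ(P|Q,R)`, obtained from `Ψ(A|b₀,b₁)` by substituting `P, Q, R` for
`A, b₀, b₁`. -/
def evalPsi2 {Y : Type*} (Ψ : NCSeries Psi2Var) (P Q R : NCSeries Y) : NCSeries Y :=
  NCSeries.subst (fun x => match x with
    | Psi2Var.A => P
    | Psi2Var.b₀ => Q
    | Psi2Var.b₁ => R) Ψ

end

namespace NCSeries

variable {X Y : Type*}

/-! The identity comes from the change of variable u = 4z/(1+z)², under which 1 - u = (1-z)²/(1+z)².
It maps (0,1) to itself, fixing both ends. Since du/u = dz/z - 2dz/(z+1) and du/(u-1) = 2dz/(z-1) -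
2dz/(z+1), the KZ form pulls back to the three-pole form with residues A, 2B, -2(A+B)
(`quadraticMap_pullback`). So G₀(u(z)), G₁(u(z)) and the specialised H₀, H₁ solve the same equation.
As u ~ 4z at 0 and 1-u ~ (1-z)²/4 at 1, comparing asymptotics gives H₀ = G₀(u) 4^(-A) and H₁ = G₁(u)
4^B, whence Ψ₂ = 4^(-B) Φ 4^(-A).

Everything else is induction on word length: the forms have no constant term, so each coefficient of
a solution is governed by shorter words. Existence (`exists_solution_zero`) writes G = F z^a with F
regular at 0 and F(0) = 1. Uniqueness (`eq_of_hasDeriv_of_tendsTo`) looks at the lowest-degree term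
of the right factor relating two solutions. The substitution is linear in the variables, hence an
algebra morphism compatible with exponentials, limits and derivatives. -/

theorem coeff_sub (f g : NCSeries X) (w : List X) :
    (f - g).coeff w = f.coeff w - g.coeff w := by
  rw [sub_eq_add_neg, coeff_add, coeff_neg, sub_eq_add_neg]

theorem coeff_sum {ι : Type*} (s : Finset ι) (f : ι → NCSeries X) (w : List X) :
    (∑ i ∈ s, f i).coeff w = ∑ i ∈ s, (f i).coeff w := by
  classical
  induction s using Finset.induction_on with
  | empty => simp [coeff_zero]
  | insert i s hi ih => rw [Finset.sum_insert hi, Finset.sum_insert hi, coeff_add, ih]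

/-! ### Lowest-degree terms -/

theorem coeff_mul_congr {f f' g g' : NCSeries X} {n : ℕ}
    (hf : ∀ w : List X, w.length ≤ n → f.coeff w = f'.coeff w)
    (hg : ∀ w : List X, w.length ≤ n → g.coeff w = g'.coeff w) {w : List X}
    (hw : w.length ≤ n) : (f * g).coeff w = (f' * g').coeff w := by
  rw [coeff_mul, coeff_mul]
  refine Finset.sum_congr rfl fun i _ => ?_
  rw [hf, hg]
  · rw [List.length_drop]; omega
  · rw [List.length_take]; omega

theorem coeff_mul_eq_zero_of_lt {f g : NCSeries X} {m n : ℕ}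
    (hf : ∀ w : List X, w.length < m → f.coeff w = 0)
    (hg : ∀ w : List X, w.length < n → g.coeff w = 0) {w : List X}
    (hw : w.length < m + n) : (f * g).coeff w = 0 := by
  rw [coeff_mul]
  refine Finset.sum_eq_zero fun i _ => ?_
  by_cases h : (w.take i).length < m
  · rw [hf _ h, zero_mul]
  · rw [hg, mul_zero]
    rw [List.length_take] at h
    rw [List.length_drop]
    omega

theorem coeff_mul_of_lowest_right {f g : NCSeries X} {w : List X}
    (hg : ∀ v : List X, v.length < w.length → g.coeff v = 0) :
    (f * g).coeff w = f.coeff [] * g.coeff w := by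
  rw [coeff_mul, Finset.sum_eq_single 0]
  · simp
  · intro i hi h0
    rw [Finset.mem_range] at hi
    rw [hg, mul_zero]
    rw [List.length_drop]
    omega
  · simp

theorem coeff_mul_of_lowest_left {f g : NCSeries X} {w : List X}
    (hf : ∀ v : List X, v.length < w.length → f.coeff v = 0) :
    (f * g).coeff w = f.coeff w * g.coeff [] := by
  rw [coeff_mul, Finset.sum_eq_single w.length]
  · simp
  · intro i hi h0
    rw [Finset.mem_range] at hi
    rw [hf, zero_mul]
    rw [List.length_take]
    omega
  · simp

theorem coeff_pow_eq_zero {f : NCSeries X} (hf : f.coeff [] = 0) (k : ℕ) {w : List X}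
    (hw : w.length < k) : (f ^ k).coeff w = 0 := by
  induction k generalizing w with
  | zero => omega
  | succ k ih =>
    rw [pow_succ]
    refine coeff_mul_eq_zero_of_lt (m := k) (n := 1) (fun v hv => ih hv) (fun v hv => ?_) hw
    rw [Nat.lt_one_iff, List.length_eq_zero_iff] at hv
    rw [hv, hf]

/-! ### Invertibility -/

/-- The coefficients of the right inverse of a series. -/
noncomputable def invCoeff (f : NCSeries X) : List X → ℂ
  | [] => (f.coeff [])⁻¹
  | x :: w => -(f.coeff [])⁻¹ *
      ∑ i ∈ Finset.range (w.length + 1), f.coeff (x :: w.take i) * invCoeff f (w.drop i)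
termination_by w => w.length
decreasing_by simp only [List.length_drop, List.length_cons]; omega

theorem mul_invCoeff {f : NCSeries X} (hf : f.coeff [] ≠ 0) : f * ⟨invCoeff f⟩ = 1 := by
  ext w
  cases w with
  | nil => rw [coeff_mul_nil]; simp [invCoeff, coeff_one, hf]
  | cons x w =>
    rw [coeff_mul_cons, coeff_mul]
    simp only [coeff_one]
    rw [invCoeff, ← mul_assoc, mul_neg, mul_inv_cancel₀ hf]
    simp

/-- The right inverse also has nonzero constant term, so it has a right inverse of its own, which
must be `f`; the inverse is therefore two-sided. -/
theorem isUnit_of_coeff_nil_ne_zero {f : NCSeries X} (hf : f.coeff [] ≠ 0) : IsUnit f := by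
  have h1 := mul_invCoeff hf
  have hg : (⟨invCoeff f⟩ : NCSeries X).coeff [] ≠ 0 := by simpa [invCoeff] using hf
  have h2 := mul_invCoeff hg
  have h3 : f = ⟨invCoeff ⟨invCoeff f⟩⟩ := left_inv_eq_right_inv h1 h2
  refine ⟨⟨f, ⟨invCoeff f⟩, h1, ?_⟩, rfl⟩
  rw [← h3] at h2
  exact h2

/-! ### Coefficientwise limits and derivatives -/

theorem TendsTo.mul {T : Type*} {F G : T → NCSeries X} {l : Filter T} {L M : NCSeries X}
    (hF : TendsTo F l L) (hG : TendsTo G l M) : TendsTo (fun t => F t * G t) l (L * M) :=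
  fun w => tendsto_finsetSum (Finset.range (w.length + 1)) fun i _ =>
    (hF (w.take i)).mul (hG (w.drop i))

theorem TendsTo.congr' {T : Type*} {F G : T → NCSeries X} {l : Filter T} {L : NCSeries X}
    (hF : TendsTo F l L) (h : ∀ᶠ t in l, F t = G t) : TendsTo G l L :=
  fun w => (hF w).congr' (h.mono fun t ht => by rw [ht])

theorem TendsTo.comp {S T : Type*} {F : T → NCSeries X} {l : Filter T} {L : NCSeries X}
    (hF : TendsTo F l L) {φ : S → T} {k : Filter S} (hφ : Tendsto φ k l) :
    TendsTo (fun t => F (φ t)) k L :=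
  fun w => (hF w).comp hφ

theorem HasDeriv.mul {F G : ℝ → NCSeries X} {F' G' : NCSeries X} {z : ℝ}
    (hF : HasDeriv F F' z) (hG : HasDeriv G G' z) :
    HasDeriv (fun t => F t * G t) (F' * G z + F z * G') z := by
  intro w
  simp only [coeff_add, coeff_mul, ← Finset.sum_add_distrib]
  exact HasDerivAt.fun_sum fun i _ => (hF _).mul (hG _)

theorem HasDeriv.mul_const {F : ℝ → NCSeries X} {F' : NCSeries X} {z : ℝ}
    (hF : HasDeriv F F' z) (K : NCSeries X) : HasDeriv (fun t => F t * K) (F' * K) z := by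
  have h := hF.mul (G := fun _ => K) (G' := 0) fun w => hasDerivAt_const z _
  simpa using h

theorem HasDeriv.sub {F G : ℝ → NCSeries X} {F' G' : NCSeries X} {z : ℝ}
    (hF : HasDeriv F F' z) (hG : HasDeriv G G' z) :
    HasDeriv (fun t => F t - G t) (F' - G') z := by
  intro w
  simp only [coeff_sub]
  exact (hF w).sub (hG w)

theorem HasDeriv.scomp {F : ℝ → NCSeries X} {F' : NCSeries X} {φ : ℝ → ℝ} {φ' z : ℝ}
    (hF : HasDeriv F F' (φ z)) (hφ : HasDerivAt φ φ' z) :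
    HasDeriv (fun t => F (φ t)) ((φ' : ℂ) • F') z := by
  intro w
  have h := (hF w).scomp z hφ
  rwa [Complex.real_smul] at h

theorem HasDeriv.congr_deriv {F : ℝ → NCSeries X} {D D' : NCSeries X} {z : ℝ}
    (hF : HasDeriv F D z) (h : D = D') : HasDeriv F D' z := h ▸ hF

/-! ### Exponentials -/

/-- The truncated exponential series of `t • f`. -/
noncomputable def expTrunc (N : ℕ) (t : ℂ) (f : NCSeries X) : NCSeries X :=
  ∑ k ∈ Finset.range (N + 1), (((k.factorial : ℂ))⁻¹ * t ^ k) • f ^ k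

/-- Since `f ^ k` has no terms of degree below `k`, each coefficient of the exponential is a
polynomial in `t`. All later analysis of exponentials rests on this. -/
theorem coeff_exp_smul {f : NCSeries X} (hf : f.coeff [] = 0) (t : ℂ) {N : ℕ} {w : List X}
    (hw : w.length ≤ N) : (exp (t • f)).coeff w = (expTrunc N t f).coeff w := by
  rw [expTrunc, coeff_sum]
  change ∑' k : ℕ, ((k.factorial : ℂ))⁻¹ * ((t • f) ^ k).coeff w = _
  rw [tsum_eq_sum (s := Finset.range (N + 1))]
  · refine Finset.sum_congr rfl fun k _ => ?_
    rw [smul_pow, coeff_smul, coeff_smul, mul_assoc]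
  · intro k hk
    rw [Finset.mem_range, not_lt] at hk
    rw [coeff_pow_eq_zero _ _ (by omega), mul_zero]
    rw [coeff_smul, hf, mul_zero]

theorem exp_smul_coeff_nil {f : NCSeries X} (hf : f.coeff [] = 0) (t : ℂ) :
    (exp (t • f)).coeff [] = 1 := by
  rw [coeff_exp_smul hf t (N := 0) le_rfl]
  simp [expTrunc, coeff_one]

theorem exp_zero_smul {f : NCSeries X} (hf : f.coeff [] = 0) : exp ((0 : ℂ) • f) = 1 := by
  ext w
  rw [coeff_exp_smul hf 0 le_rfl, expTrunc, Finset.sum_range_succ']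
  simp

theorem commute_exp_smul {f : NCSeries X} (hf : f.coeff [] = 0) (t : ℂ) :
    f * exp (t • f) = exp (t • f) * f := by
  ext w
  have h : ∀ v : List X, v.length ≤ w.length →
      (exp (t • f)).coeff v = (expTrunc w.length t f).coeff v := fun v hv =>
    coeff_exp_smul hf t hv
  rw [coeff_mul_congr (fun _ _ => rfl) h le_rfl, coeff_mul_congr h (fun _ _ => rfl) le_rfl]
  congr 1
  simp only [expTrunc, Finset.mul_sum, Finset.sum_mul, mul_smul_comm, smul_mul_assoc,
    ← pow_succ, ← pow_succ']

theorem hasDeriv_exp_smul {f : NCSeries X} (hf : f.coeff [] = 0) (t : ℝ) :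
    HasDeriv (fun s : ℝ => exp ((s : ℂ) • f)) (f * exp ((t : ℂ) • f)) t := by
  intro w
  have h : ∀ s : ℝ, (exp ((s : ℂ) • f)).coeff w =
      ∑ k ∈ Finset.range (w.length + 1),
        ((k.factorial : ℂ))⁻¹ * (s : ℂ) ^ k * (f ^ k).coeff w := fun s => by
    rw [coeff_exp_smul hf _ le_rfl, expTrunc, coeff_sum]
    rfl
  simp only [h]
  have h2 : (f * exp ((t : ℂ) • f)).coeff w =
      ∑ k ∈ Finset.range (w.length + 1),
        ((k.factorial : ℂ))⁻¹ * ((k : ℂ) * (t : ℂ) ^ (k - 1) * 1) * (f ^ k).coeff w := by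
    -- Differentiation shifts the index by one: the `k = 0` term on the right vanishes, and the top
    -- term on the left involves `f ^ (w.length + 1)`, which is zero on `w`.
    rw [coeff_mul_congr (fun _ _ => rfl) (fun v hv => coeff_exp_smul hf t hv) le_rfl, expTrunc,
      Finset.mul_sum, coeff_sum, Finset.sum_range_succ, Finset.sum_range_succ', mul_smul_comm,
      coeff_smul, ← pow_succ', coeff_pow_eq_zero hf _ (Nat.lt_succ_self _), mul_zero, add_zero]
    simp only [Nat.cast_zero, zero_mul, mul_zero, add_zero]
    refine Finset.sum_congr rfl fun k _ => ?_
    rw [mul_smul_comm, coeff_smul, ← pow_succ', Nat.factorial_succ]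
    have : (k : ℂ) + 1 ≠ 0 := by exact_mod_cast k.succ_ne_zero
    have : (k.factorial : ℂ) ≠ 0 := by exact_mod_cast k.factorial_ne_zero
    push_cast
    field_simp
  rw [h2]
  refine HasDerivAt.fun_sum fun k _ => ?_
  exact (((hasDerivAt_id t).ofReal_comp.pow k).const_mul _).mul_const _

/-- The function r ↦ exp(r f) exp((s+t-r) f) has zero derivative; its values at r = s and r = 0 are
compared. -/
theorem exp_add_smul {f : NCSeries X} (hf : f.coeff [] = 0) (s t : ℝ) :
    exp (((s + t : ℝ) : ℂ) • f) = exp ((s : ℂ) • f) * exp ((t : ℂ) • f) := by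
  have hd : ∀ r : ℝ, HasDeriv
      (fun r : ℝ => exp ((r : ℂ) • f) * exp (((s + t - r : ℝ) : ℂ) • f)) 0 r := fun r => by
    have h1 := hasDeriv_exp_smul hf r
    have h2 := (hasDeriv_exp_smul hf (s + t - r)).scomp (φ := fun r => s + t - r)
      ((hasDerivAt_id r).const_sub (s + t))
    refine (h1.mul h2).congr_deriv ?_
    rw [commute_exp_smul hf (r : ℂ)]
    simp [mul_assoc]
  ext w
  have hc := is_const_of_deriv_eq_zero (fun r => (hd r w).differentiableAt)
    (fun r => (hd r w).deriv) s 0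
  simp only [add_sub_cancel_left, sub_zero, Complex.ofReal_zero, exp_zero_smul hf, one_mul] at hc
  exact hc.symm

theorem tendsTo_exp_smul {f : NCSeries X} (hf : f.coeff [] = 0) {T : Type*} {l : Filter T}
    {φ : T → ℝ} (hφ : Tendsto φ l (𝓝 0)) : TendsTo (fun t => exp ((φ t : ℂ) • f)) l 1 := by
  intro w
  have h := ((hasDeriv_exp_smul hf 0 w).continuousAt.tendsto).comp hφ
  beta_reduce at h
  rw [Complex.ofReal_zero, exp_zero_smul hf] at h
  exact h

theorem rpow_neg (a : ℝ) (f : NCSeries X) :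
    rpow a (-f) = exp (((-Real.log a : ℝ) : ℂ) • f) := by
  rw [rpow, smul_neg, Complex.ofReal_neg, neg_smul]

theorem rpow_mul_rpow_neg {f : NCSeries X} (hf : f.coeff [] = 0) (a : ℝ) :
    rpow a f * rpow a (-f) = 1 := by
  rw [rpow_neg, rpow, ← exp_add_smul hf, add_neg_cancel, Complex.ofReal_zero, exp_zero_smul hf]

theorem hasDeriv_rpow {f : NCSeries X} (hf : f.coeff [] = 0) {z : ℝ} (hz : z ≠ 0) :
    HasDeriv (fun z : ℝ => rpow z f) ((z : ℂ)⁻¹ • (f * rpow z f)) z := by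
  have h := (hasDeriv_exp_smul hf (Real.log z)).scomp (Real.hasDerivAt_log hz)
  rw [Complex.ofReal_inv] at h
  exact h

theorem coeff_var_nil (x : X) : (var x : NCSeries X).coeff [] = 0 := by
  simp [var]

/-! ### Uniqueness of solutions -/

/-- As `Ω` has no constant term, the derivative of a coefficient of `D` involves only shorter words.
By induction on length these vanish, so each coefficient is constant and equal to its value at `c`.
-/
theorem eq_zero_of_hasDeriv {Ω D : ℝ → NCSeries X} {a b c : ℝ}
    (hΩ : ∀ z ∈ Set.Ioo a b, (Ω z).coeff [] = 0)
    (hD : ∀ z ∈ Set.Ioo a b, HasDeriv D (Ω z * D z) z) (hc : c ∈ Set.Ioo a b) (h0 : D c = 0) :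
    ∀ z ∈ Set.Ioo a b, D z = 0 := by
  have key : ∀ n : ℕ, ∀ w : List X, w.length ≤ n → ∀ z ∈ Set.Ioo a b, (D z).coeff w = 0 := by
    intro n
    induction n using Nat.strong_induction_on with
    | _ n ih =>
      intro w hw z hz
      have hder : ∀ y ∈ Set.Ioo a b, HasDerivAt (fun t => (D t).coeff w) 0 y := by
        intro y hy
        have h := hD y hy w
        rwa [coeff_mul_of_lowest_right, hΩ y hy, zero_mul] at h
        intro v hv
        exact ih v.length (by omega) v le_rfl y hy
      have h := isOpen_Ioo.is_const_of_deriv_eq_zero isPreconnected_Ioo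
        (fun y hy => (hder y hy).differentiableAt.differentiableWithinAt)
        (fun y hy => (hder y hy).deriv) hz hc
      simpa [h0, coeff_zero] using h
  intro z hz
  ext w
  exact key _ w le_rfl z hz

theorem eq_mul_of_hasDeriv {Ω G H : ℝ → NCSeries X} {a b c : ℝ} {K : NCSeries X}
    (hΩ : ∀ z ∈ Set.Ioo a b, (Ω z).coeff [] = 0)
    (hG : ∀ z ∈ Set.Ioo a b, HasDeriv G (Ω z * G z) z)
    (hH : ∀ z ∈ Set.Ioo a b, HasDeriv H (Ω z * H z) z) (hc : c ∈ Set.Ioo a b)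
    (hK : G c = H c * K) : ∀ z ∈ Set.Ioo a b, G z = H z * K := by
  intro z hz
  refine sub_eq_zero.1 (eq_zero_of_hasDeriv (D := fun z => G z - H z * K) hΩ (fun y hy => ?_) hc
    (sub_eq_zero.2 hK) z hz)
  refine ((hG y hy).sub ((hH y hy).mul_const K)).congr_deriv ?_
  rw [mul_sub, mul_assoc]

/-- Two solutions with the same asymptotic behaviour coincide. -/
theorem eq_of_hasDeriv_of_tendsTo {Ω G H r : ℝ → NCSeries X} {a b c : ℝ} {l : Filter ℝ} [l.NeBot]
    (hΩ : ∀ z ∈ Set.Ioo a b, (Ω z).coeff [] = 0)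
    (hG : ∀ z ∈ Set.Ioo a b, HasDeriv G (Ω z * G z) z)
    (hH : ∀ z ∈ Set.Ioo a b, HasDeriv H (Ω z * H z) z) (hc : c ∈ Set.Ioo a b)
    (hu : IsUnit (H c)) (hl : ∀ᶠ z in l, z ∈ Set.Ioo a b) (hr : ∀ z, (r z).coeff [] = 1)
    (hGr : TendsTo (fun z => G z * r z) l 1) (hHr : TendsTo (fun z => H z * r z) l 1) :
    ∀ z ∈ Set.Ioo a b, G z = H z := by
  obtain ⟨u, hu⟩ := hu
  have hK := eq_mul_of_hasDeriv hΩ hG hH hc (K := (↑u⁻¹ : NCSeries X) * G c)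
    (by rw [← hu, ← mul_assoc, Units.mul_inv, one_mul])
  set K : NCSeries X := (↑u⁻¹ : NCSeries X) * G c
  suffices hK1 : K - 1 = 0 by
    intro z hz
    rw [hK z hz, sub_eq_zero.1 hK1, mul_one]
  have hH1 : Tendsto (fun z => (H z).coeff []) l (𝓝 1) := by
    have h := hHr []
    simpa [coeff_mul_nil, hr, coeff_one] using h
  -- On a word `w` of lowest degree in `K - 1`, the coefficient of (G - H) r = H (K - 1) r is `(H
  -- z).coeff [] * (K - 1).coeff w`. The left side tends to 0 and the constant term of `H` to 1, so
  -- this coefficient of `K - 1` is zero.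
  have key : ∀ n : ℕ, ∀ w : List X, w.length = n → (K - 1).coeff w = 0 := by
    intro n
    induction n using Nat.strong_induction_on with
    | _ n ih =>
      intro w hw
      have ih' : ∀ v : List X, v.length < w.length → (K - 1).coeff v = 0 :=
        fun v hv => ih _ (hw ▸ hv) v rfl
      have h1 : Tendsto (fun z => (H z).coeff [] * (K - 1).coeff w) l
          (𝓝 (1 * (K - 1).coeff w)) := hH1.mul_const _
      have h2 : Tendsto (fun z => (H z).coeff [] * (K - 1).coeff w) l (𝓝 0) := by
        have h := (hGr w).sub (hHr w)
        rw [sub_self] at h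
        refine h.congr' (hl.mono fun z hz => ?_)
        rw [← coeff_sub]
        beta_reduce
        rw [hK z hz, ← sub_mul, ← mul_sub_one, coeff_mul_of_lowest_left, hr, mul_one,
          coeff_mul_of_lowest_right ih']
        intro v hv
        rw [coeff_mul_of_lowest_right fun v' hv' => ih' v' (hv'.trans hv), ih' v hv, mul_zero]
      simpa using tendsto_nhds_unique h1 h2
  ext w
  exact key _ w rfl

/-! ### Linear series -/

/-- A series is linear if it is homogeneous of degree one. -/
def IsLinear (f : NCSeries X) : Prop := ∀ w : List X, w.length ≠ 1 → f.coeff w = 0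

theorem IsLinear.coeff_nil {f : NCSeries X} (hf : IsLinear f) : f.coeff [] = 0 := hf [] (by simp)

theorem isLinear_var (x : X) : IsLinear (var x : NCSeries X) := by
  intro w hw
  have : w ≠ [x] := by rintro rfl; simp at hw
  simp [var, this]

theorem IsLinear.add {f g : NCSeries X} (hf : IsLinear f) (hg : IsLinear g) :
    IsLinear (f + g) := fun w hw => by rw [coeff_add, hf w hw, hg w hw, add_zero]

theorem IsLinear.smul {f : NCSeries X} (hf : IsLinear f) (c : ℂ) : IsLinear (c • f) :=
  fun w hw => by rw [coeff_smul, hf w hw, mul_zero]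

theorem IsLinear.coeff_mul_cons {f : NCSeries X} (hf : IsLinear f) (g : NCSeries X) (x : X)
    (w : List X) : (f * g).coeff (x :: w) = f.coeff [x] * g.coeff w := by
  have h : (⟨fun v => f.coeff (x :: v)⟩ : NCSeries X) = f.coeff [x] • 1 := by
    ext v
    cases v with
    | nil => simp [coeff_smul, coeff_one]
    | cons y v => simp [coeff_smul, coeff_one, hf (x :: y :: v)]
  rw [NCSeries.coeff_mul_cons, hf.coeff_nil, zero_mul, zero_add, h, smul_mul_assoc, one_mul,
    coeff_smul]

theorem IsLinear.coeff_cons_mul {f : NCSeries X} (hf : IsLinear f) (g : NCSeries X) (x : X)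
    (w : List X) : (g * f).coeff (x :: w) =
      g.coeff ((x :: w).take w.length) * f.coeff ((x :: w).drop w.length) := by
  rw [coeff_mul, Finset.sum_eq_single w.length]
  · intro i hi h
    rw [Finset.mem_range, List.length_cons] at hi
    rw [hf, mul_zero]
    rw [List.length_drop, List.length_cons]
    omega
  · simp

/-! ### Existence of solutions with given asymptotics -/

/-- The coefficients of the regular factor `F` of the solution `F(z) z ^ a` of the equation
`(dG) G⁻¹ = (a / z + R(z)) dz`, for linear series `a` and `R(z)`. -/
noncomputable def regularFactor (a : NCSeries X) (R : ℝ → NCSeries X) : List X → ℝ → ℂ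
  | [] => fun _ => 1
  -- This integrates F' = (a/z + R) F - F a/z coefficientwise. Linearity of `a` leaves only the word
  -- without its first letter in a F and without its last letter in F a. The singular part (a F - F
  -- a)/z may be computed with difference quotients at 0 because F(0) = 1 commutes with `a`.
  | x :: w => fun z => ∫ t in (0 : ℝ)..z,
      ((R t).coeff [x] * regularFactor a R w t + a.coeff [x] * dslope (regularFactor a R w) 0 t -
        dslope (regularFactor a R ((x :: w).take w.length)) 0 t *
          a.coeff ((x :: w).drop w.length))
termination_by w => w.length
decreasing_by all_goals simp

theorem hasDerivAt_integral_of_continuousOn {g : ℝ → ℂ} (hg : ContinuousOn g (Set.Ioo (-1) 1))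
    {z : ℝ} (hz : z ∈ Set.Ioo (-1 : ℝ) 1) :
    HasDerivAt (fun y => ∫ t in (0 : ℝ)..y, g t) (g z) z := by
  have h0 : (0 : ℝ) ∈ Set.Ioo (-1 : ℝ) 1 := by simp
  refine intervalIntegral.integral_hasDerivAt_right ?_
    (hg.stronglyMeasurableAtFilter isOpen_Ioo z hz) (hg.continuousAt (isOpen_Ioo.mem_nhds hz))
  refine (hg.mono ?_).intervalIntegrable
  exact Set.OrdConnected.uIcc_subset Set.ordConnected_Ioo h0 hz

/-- Differentiability at 0 of the shorter coefficients makes their `dslope` continuous across 0, so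
the integrand is continuous and the next coefficient is again differentiable at 0. This is why the
interval is (-1,1) and not (0,1). -/
theorem hasDerivAt_regularFactor_cons {a : NCSeries X} {R : ℝ → NCSeries X}
    (hR : ∀ x, ContinuousOn (fun t => (R t).coeff [x]) (Set.Ioo (-1) 1)) (n : ℕ) :
    (∀ w : List X, w.length ≤ n → ∀ z ∈ Set.Ioo (-1 : ℝ) 1,
      DifferentiableAt ℝ (regularFactor a R w) z) ∧
    ∀ (x : X) (w : List X), w.length ≤ n → ∀ z ∈ Set.Ioo (-1 : ℝ) 1,
      HasDerivAt (regularFactor a R (x :: w))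
        ((R z).coeff [x] * regularFactor a R w z + a.coeff [x] * dslope (regularFactor a R w) 0 z -
          dslope (regularFactor a R ((x :: w).take w.length)) 0 z *
            a.coeff ((x :: w).drop w.length)) z := by
  have h0 : (0 : ℝ) ∈ Set.Ioo (-1 : ℝ) 1 := by simp
  have step : ∀ m : ℕ, (∀ w : List X, w.length ≤ m → ∀ z ∈ Set.Ioo (-1 : ℝ) 1,
      DifferentiableAt ℝ (regularFactor a R w) z) →
    ∀ (x : X) (w : List X), w.length ≤ m → ∀ z ∈ Set.Ioo (-1 : ℝ) 1,
      HasDerivAt (regularFactor a R (x :: w))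
        ((R z).coeff [x] * regularFactor a R w z + a.coeff [x] * dslope (regularFactor a R w) 0 z -
          dslope (regularFactor a R ((x :: w).take w.length)) 0 z *
            a.coeff ((x :: w).drop w.length)) z := by
    intro m hm x w hw z hz
    have hc : ∀ v : List X, v.length ≤ m →
        ContinuousOn (regularFactor a R v) (Set.Ioo (-1) 1) := fun v hv y hy =>
      (hm v hv y hy).continuousAt.continuousWithinAt
    have hs : ∀ v : List X, v.length ≤ m →
        ContinuousOn (dslope (regularFactor a R v) 0) (Set.Ioo (-1) 1) := fun v hv =>
      (continuousOn_dslope (isOpen_Ioo.mem_nhds h0)).2 ⟨hc v hv, hm v hv 0 h0⟩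
    rw [regularFactor]
    refine hasDerivAt_integral_of_continuousOn (g := fun z =>
      (R z).coeff [x] * regularFactor a R w z + a.coeff [x] * dslope (regularFactor a R w) 0 z -
          dslope (regularFactor a R ((x :: w).take w.length)) 0 z *
            a.coeff ((x :: w).drop w.length)) ?_ hz
    refine (((hR x).mul (hc w hw)).add (continuousOn_const.mul (hs w hw))).sub
      ((hs _ ?_).mul continuousOn_const)
    simpa using hw
  have main : ∀ w : List X, w.length ≤ n → ∀ z ∈ Set.Ioo (-1 : ℝ) 1,
      DifferentiableAt ℝ (regularFactor a R w) z := by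
    induction n with
    | zero =>
      intro w hw z _
      rw [Nat.le_zero, List.length_eq_zero_iff] at hw
      subst hw
      rw [regularFactor]
      exact differentiableAt_const _
    | succ n ih =>
      intro w hw z hz
      cases w with
      | nil =>
        rw [regularFactor]
        exact differentiableAt_const _
      | cons x w => exact (step n ih x w (by simpa using hw) z hz).differentiableAt
  exact ⟨main, step n main⟩

theorem regularFactor_zero (a : NCSeries X) (R : ℝ → NCSeries X) (w : List X) :
    regularFactor a R w 0 = (1 : NCSeries X).coeff w := by
  cases w <;> simp [regularFactor, coeff_one]

theorem hasDeriv_regularFactor {a : NCSeries X} {R : ℝ → NCSeries X} (ha : IsLinear a)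
    (hRl : ∀ t, IsLinear (R t))
    (hR : ∀ x, ContinuousOn (fun t => (R t).coeff [x]) (Set.Ioo (-1) 1)) {z : ℝ}
    (hz : z ∈ Set.Ioo (0 : ℝ) 1) :
    HasDeriv (fun t => ⟨fun w => regularFactor a R w t⟩)
      (((z : ℂ)⁻¹ • a + R z) * ⟨fun w => regularFactor a R w z⟩ -
        (z : ℂ)⁻¹ • ((⟨fun w => regularFactor a R w z⟩ : NCSeries X) * a)) z := by
  have hz0 : z ≠ 0 := hz.1.ne'
  intro w
  cases w with
  | nil =>
    have : (fun t : ℝ => regularFactor a R [] t) = fun _ => 1 := by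
      rw [regularFactor]
    simp only [this, coeff_sub, coeff_mul_nil, coeff_add, coeff_smul, ha.coeff_nil,
      (hRl z).coeff_nil]
    simpa using hasDerivAt_const z (1 : ℂ)
  | cons x w =>
    refine ((hasDerivAt_regularFactor_cons hR w.length).2 x w le_rfl z
      ⟨by linarith [hz.1], hz.2⟩).congr_deriv ?_
    rw [coeff_sub, ((ha.smul _).add (hRl z)).coeff_mul_cons, coeff_smul, ha.coeff_cons_mul,
      coeff_add, coeff_smul, dslope_of_ne _ hz0, dslope_of_ne _ hz0, slope_def_module,
      slope_def_module, regularFactor_zero, regularFactor_zero]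
    -- The values at 0 subtracted in the two difference quotients cancel, because a · 1 = 1 · a.
    have hw : a.coeff [x] * (1 : NCSeries X).coeff w =
        (1 : NCSeries X).coeff ((x :: w).take w.length) *
          a.coeff ((x :: w).drop w.length) := by
      rw [← ha.coeff_mul_cons, ← ha.coeff_cons_mul, one_mul, mul_one]
    simp only [sub_zero, Complex.real_smul, Complex.ofReal_inv]
    linear_combination (-(z : ℂ)⁻¹) * hw

/-- The equation `(dG) G⁻¹ = (a / z + R(z)) dz` has a solution such that `G(z) ≃ z ^ a`. -/
theorem exists_solution_zero {a : NCSeries X} {R : ℝ → NCSeries X} (ha : IsLinear a)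
    (hRl : ∀ t, IsLinear (R t))
    (hR : ∀ x, ContinuousOn (fun t => (R t).coeff [x]) (Set.Ioo (-1) 1)) :
    ∃ G : ℝ → (NCSeries X)ˣ, IsSolution (fun z => (z : ℂ)⁻¹ • a + R z) G ∧
      TendsTo (fun z : ℝ => (G z : NCSeries X) * rpow z (-a)) (𝓝[>] (0 : ℝ)) 1 := by
  set F : ℝ → NCSeries X := fun t => ⟨fun w => regularFactor a R w t⟩ with hF
  have hu : ∀ z, IsUnit (F z * rpow z a) := fun z => by
    refine isUnit_of_coeff_nil_ne_zero ?_
    rw [coeff_mul_nil, rpow, exp_smul_coeff_nil ha.coeff_nil]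
    simp [hF, regularFactor]
  refine ⟨fun z => (hu z).unit, fun z hz => ?_, ?_⟩
  · simp only [IsUnit.unit_spec]
    refine ((hasDeriv_regularFactor ha hRl hR hz).mul
      (hasDeriv_rpow ha.coeff_nil hz.1.ne')).congr_deriv ?_
    -- The term -z⁻¹ F a z^a coming from F' cancels the derivative of the factor z^a.
    rw [sub_mul, mul_assoc, smul_mul_assoc, mul_smul_comm, mul_assoc]
    exact sub_add_cancel _ _
  · simp only [IsUnit.unit_spec, mul_assoc, rpow_mul_rpow_neg ha.coeff_nil, mul_one]
    intro w
    have h : ContinuousAt (regularFactor a R w) 0 :=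
      ((hasDerivAt_regularFactor_cons hR w.length).1 w le_rfl 0 (by simp)).continuousAt
    have h' := h.tendsto.mono_left (nhdsWithin_le_nhds (s := Set.Ioi 0))
    rwa [regularFactor_zero] at h'

/-- The equation `(dG) G⁻¹ = (b / (z - 1) - R(1 - z)) dz` has a solution such that
`G(z) ≃ (1 - z) ^ b`. -/
theorem exists_solution_one {b : NCSeries X} {R : ℝ → NCSeries X} (hb : IsLinear b)
    (hRl : ∀ t, IsLinear (R t))
    (hR : ∀ x, ContinuousOn (fun t => (R t).coeff [x]) (Set.Ioo (-1) 1)) :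
    ∃ G : ℝ → (NCSeries X)ˣ, IsSolution (fun z => ((z : ℂ) - 1)⁻¹ • b - R (1 - z)) G ∧
      TendsTo (fun z : ℝ => (G z : NCSeries X) * rpow (1 - z) (-b)) (𝓝[<] (1 : ℝ)) 1 := by
  obtain ⟨G, hG, hG1⟩ := exists_solution_zero hb hRl hR
  refine ⟨fun z => G (1 - z), fun z hz => ?_, hG1.comp (φ := fun z => 1 - z) ?_⟩
  · have h := (hG (1 - z) ⟨by linarith [hz.2], by linarith [hz.1]⟩).scomp
      (φ := fun z => 1 - z) ((hasDerivAt_id z).const_sub 1)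
    refine h.congr_deriv ?_
    rw [← smul_mul_assoc, smul_add, smul_smul]
    congr 1
    beta_reduce
    rw [← neg_sub (1 : ℂ) z, inv_neg]
    push_cast
    module
  · refine tendsto_nhdsWithin_iff.2 ⟨?_, ?_⟩
    · refine Tendsto.mono_left ?_ nhdsWithin_le_nhds
      exact Continuous.tendsto' (by fun_prop) _ _ (by simp)
    · filter_upwards [self_mem_nhdsWithin] with z hz
      simpa using hz

/-- The renormalized holonomy exists and is unique. -/
theorem existsUnique_isRenormalizedHolonomy {Ω : ℝ → NCSeries X} {a b : NCSeries X}
    {R S : ℝ → NCSeries X} (ha : IsLinear a) (hb : IsLinear b)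
    (hRl : ∀ t, IsLinear (R t)) (hSl : ∀ t, IsLinear (S t))
    (hR : ∀ x, ContinuousOn (fun t => (R t).coeff [x]) (Set.Ioo (-1) 1))
    (hS : ∀ x, ContinuousOn (fun t => (S t).coeff [x]) (Set.Ioo (-1) 1))
    (hΩR : ∀ z, Ω z = (z : ℂ)⁻¹ • a + R z) (hΩS : ∀ z, Ω z = ((z : ℂ) - 1)⁻¹ • b - S (1 - z)) :
    ∃! Φ, IsRenormalizedHolonomy Ω a b Φ := by
  have hΩ0 : ∀ z ∈ Set.Ioo (0 : ℝ) 1, (Ω z).coeff [] = 0 := fun z _ => by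
    rw [hΩR]
    exact ((ha.smul _).add (hRl z)).coeff_nil
  have hc : (1 / 2 : ℝ) ∈ Set.Ioo (0 : ℝ) 1 := by constructor <;> norm_num
  obtain ⟨G₀, hG₀, hG₀'⟩ := exists_solution_zero ha hRl hR
  obtain ⟨G₁, hG₁, hG₁'⟩ := exists_solution_one hb hSl hS
  rw [← funext hΩR] at hG₀
  rw [← funext hΩS] at hG₁
  refine ⟨((G₁ (1 / 2))⁻¹ : (NCSeries X)ˣ) * (G₀ (1 / 2) : NCSeries X),
    ⟨G₀, G₁, hG₀, hG₁, hG₀', hG₁', fun z hz => ?_⟩, ?_⟩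
  · rw [Units.eq_inv_mul_iff_mul_eq, eq_comm]
    refine eq_mul_of_hasDeriv hΩ0 hG₀ hG₁ hc ?_ z hz
    rw [← mul_assoc, Units.mul_inv, one_mul]
  · rintro Φ ⟨H₀, H₁, hH₀, hH₁, hH₀', hH₁', hΦ⟩
    have e₀ := eq_of_hasDeriv_of_tendsTo hΩ0 hH₀ hG₀ hc (G₀ _).isUnit
      (Ioo_mem_nhdsGT zero_lt_one) (fun z => by
        rw [rpow_neg, exp_smul_coeff_nil ha.coeff_nil]) hH₀' hG₀' _ hc
    have e₁ := eq_of_hasDeriv_of_tendsTo hΩ0 hH₁ hG₁ hc (G₁ _).isUnit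
      (Ioo_mem_nhdsLT zero_lt_one) (fun z => by
        rw [rpow_neg, exp_smul_coeff_nil hb.coeff_nil]) hH₁' hG₁' _ hc
    rw [hΦ _ hc, e₀, Units.ext e₁]

/-! ### Linear substitutions -/

/-- The series of the coefficients of the words beginning with `x`, with that letter removed. -/
def shift (x : X) (f : NCSeries X) : NCSeries X := ⟨fun v => f.coeff (x :: v)⟩

theorem coeff_shift (x : X) (f : NCSeries X) (w : List X) :
    (shift x f).coeff w = f.coeff (x :: w) := rfl

theorem shift_mul (x : X) (f g : NCSeries X) :
    shift x (f * g) = f.coeff [] • shift x g + shift x f * g := by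
  ext v
  exact coeff_mul_cons f g x v

/-- The words of length `n` over a finite alphabet. -/
noncomputable def words (X : Type*) [Fintype X] : ℕ → Finset (List X)
  | 0 => {[]}
  | n + 1 => (Finset.univ ×ˢ words X n).map
      ⟨fun p => p.1 :: p.2, fun p q h => by
        simp only [List.cons.injEq] at h
        exact Prod.ext h.1 h.2⟩

theorem mem_words [Fintype X] {n : ℕ} {v : List X} : v ∈ words X n ↔ v.length = n := by
  induction n generalizing v with
  | zero => simp [words]
  | succ n ih =>
    cases v with
    | nil => simp [words]
    | cons x v => simp [words, ih, DFunLike.coe]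

theorem coeff_map_prod_eq_zero {s : X → NCSeries Y} (hs : ∀ x, IsLinear (s x)) {v : List X}
    {w : List Y} (h : v.length ≠ w.length) : ((v.map s).prod).coeff w = 0 := by
  induction v generalizing w with
  | nil =>
    rw [List.map_nil, List.prod_nil, coeff_one, if_neg]
    simpa using Ne.symm h
  | cons x v ih =>
    rw [List.map_cons, List.prod_cons]
    cases w with
    | nil => rw [coeff_mul_nil, (hs x).coeff_nil, zero_mul]
    | cons y w =>
      rw [(hs x).coeff_mul_cons, ih (by simpa using h), mul_zero]

section Subst

variable [Fintype X] {s : X → NCSeries Y}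

/-- Linear `s` sends a word to a homogeneous series of the same degree, so only words as long as `w`
contribute, and there are finitely many of them. -/
theorem coeff_subst (hs : ∀ x, IsLinear (s x)) (f : NCSeries X) (w : List Y) :
    (subst s f).coeff w =
      ∑ v ∈ words X w.length, f.coeff v * ((v.map s).prod).coeff w := by
  refine finsum_eq_sum_of_support_subset _ fun v hv => ?_
  rw [Finset.mem_coe, mem_words]
  by_contra h
  exact hv (mul_eq_zero_of_right _ (coeff_map_prod_eq_zero hs h))

theorem coeff_subst_nil (hs : ∀ x, IsLinear (s x)) (f : NCSeries X) :
    (subst s f).coeff [] = f.coeff [] := by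
  rw [coeff_subst hs]
  simp [words, coeff_one]

/-- The letter `y` can only come from the first, linear factor. This recursion drives the proof of
multiplicativity. -/
theorem coeff_subst_cons (hs : ∀ x, IsLinear (s x)) (f : NCSeries X) (y : Y) (w : List Y) :
    (subst s f).coeff (y :: w) =
      ∑ x, (s x).coeff [y] * (subst s (shift x f)).coeff w := by
  rw [coeff_subst hs, List.length_cons, words, Finset.sum_map, Finset.sum_product]
  refine Finset.sum_congr rfl fun x _ => ?_
  rw [coeff_subst hs, Finset.mul_sum]
  refine Finset.sum_congr rfl fun v _ => ?_
  change f.coeff (x :: v) * (s x * (v.map s).prod).coeff (y :: w) = _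
  rw [(hs x).coeff_mul_cons, coeff_shift]
  ring

theorem subst_add (hs : ∀ x, IsLinear (s x)) (f g : NCSeries X) :
    subst s (f + g) = subst s f + subst s g := by
  ext w
  simp only [coeff_add, coeff_subst hs, add_mul, Finset.sum_add_distrib]

theorem subst_smul (hs : ∀ x, IsLinear (s x)) (c : ℂ) (f : NCSeries X) :
    subst s (c • f) = c • subst s f := by
  ext w
  simp only [coeff_smul, coeff_subst hs, Finset.mul_sum, mul_assoc]

theorem subst_one (hs : ∀ x, IsLinear (s x)) : subst s (1 : NCSeries X) = 1 := by
  ext w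
  cases w with
  | nil => rw [coeff_subst_nil hs]; rfl
  | cons y w =>
    rw [coeff_subst hs, Finset.sum_eq_zero]
    · rfl
    · intro v hv
      rw [mem_words] at hv
      simp [coeff_one, hv]

theorem subst_mul (hs : ∀ x, IsLinear (s x)) (f g : NCSeries X) :
    subst s (f * g) = subst s f * subst s g := by
  ext w
  induction w generalizing f with
  | nil => simp only [coeff_mul_nil, coeff_subst_nil hs]
  | cons y w ih =>
    have h : shift y (subst s f) = ∑ x, (s x).coeff [y] • subst s (shift x f) := by
      ext v
      rw [coeff_shift, coeff_subst_cons hs, coeff_sum]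
      rfl
    rw [coeff_subst_cons hs, coeff_mul_cons, ← shift, h, coeff_subst_nil hs,
      coeff_subst_cons hs, Finset.sum_mul, coeff_sum, Finset.mul_sum, ← Finset.sum_add_distrib]
    refine Finset.sum_congr rfl fun x _ => ?_
    rw [shift_mul, subst_add hs, subst_smul hs, coeff_add, coeff_smul, ih, smul_mul_assoc,
      coeff_smul]
    ring

theorem subst_pow (hs : ∀ x, IsLinear (s x)) (f : NCSeries X) (n : ℕ) :
    subst s (f ^ n) = subst s f ^ n := by
  induction n with
  | zero => rw [pow_zero, pow_zero, subst_one hs]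
  | succ n ih => rw [pow_succ, pow_succ, subst_mul hs, ih]

theorem subst_var (hs : ∀ x, IsLinear (s x)) (x : X) : subst s (var x) = s x := by
  ext w
  rw [coeff_subst hs, Finset.sum_eq_single [x]]
  · simp [var]
  · intro v _ hv
    simp [var, hv]
  · intro h
    rw [mem_words] at h
    rw [coeff_map_prod_eq_zero hs h, mul_zero]

/-- The coefficient at `w` sees only words of length `w.length`, where the exponential agrees with
its truncation; this reduces the claim to powers. -/
theorem subst_exp (hs : ∀ x, IsLinear (s x)) {f : NCSeries X} (hf : f.coeff [] = 0) (t : ℂ) :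
    subst s (exp (t • f)) = exp (t • subst s f) := by
  ext w
  have h : (subst s (exp (t • f))).coeff w = (subst s (expTrunc w.length t f)).coeff w := by
    rw [coeff_subst hs, coeff_subst hs]
    refine Finset.sum_congr rfl fun v hv => ?_
    rw [coeff_exp_smul hf t (mem_words.1 hv).le]
  rw [h, coeff_exp_smul (by rw [coeff_subst_nil hs, hf]) t le_rfl, expTrunc, expTrunc, coeff_sum,
    coeff_subst hs]
  simp only [coeff_sum, Finset.sum_mul]
  rw [Finset.sum_comm]
  refine Finset.sum_congr rfl fun k _ => ?_
  rw [← subst_pow hs, ← subst_smul hs, coeff_subst hs]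

theorem TendsTo.subst (hs : ∀ x, IsLinear (s x)) {T : Type*} {F : T → NCSeries X} {l : Filter T}
    {L : NCSeries X} (hF : TendsTo F l L) :
    TendsTo (fun t => NCSeries.subst s (F t)) l (NCSeries.subst s L) := by
  intro w
  simp only [coeff_subst hs]
  exact tendsto_finsetSum _ fun v _ => (hF v).mul_const _

theorem HasDeriv.subst (hs : ∀ x, IsLinear (s x)) {F : ℝ → NCSeries X} {D : NCSeries X} {z : ℝ}
    (hF : HasDeriv F D z) :
    HasDeriv (fun t => NCSeries.subst s (F t)) (NCSeries.subst s D) z := by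
  intro w
  simp only [coeff_subst hs]
  exact HasDerivAt.fun_sum fun v _ => (hF v).mul_const _

end Subst

end NCSeries

/-! ### The equations with poles at `0, 1` and at `0, 1, -1` -/

open NCSeries

theorem existsUnique_isKZAssociator : ∃! Φ : NCSeries KZVar, IsKZAssociator Φ := by
  have hA := isLinear_var KZVar.A
  have hB := isLinear_var KZVar.B
  have hne : ∀ t ∈ Set.Ioo (-1 : ℝ) 1, (t : ℂ) - 1 ≠ 0 := fun t ht h => by
    have : t = 1 := by exact_mod_cast sub_eq_zero.1 h
    exact ht.2.ne this
  -- `R` is the part regular at 0; `S` is written in the coordinate t = 1 - z, so that -S(1 - z) =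
  -- A/z.
  refine existsUnique_isRenormalizedHolonomy
    (R := fun t => ((t : ℂ) - 1)⁻¹ • var KZVar.B) (S := fun t => ((t : ℂ) - 1)⁻¹ • var KZVar.A)
    hA hB (fun t => hB.smul _) (fun t => hA.smul _) (fun x => ?_) (fun x => ?_) (fun z => rfl)
    (fun z => ?_)
  · simp only [coeff_smul]
    exact ContinuousOn.mul (ContinuousOn.inv₀ (by fun_prop) hne) continuousOn_const
  · simp only [coeff_smul]
    exact ContinuousOn.mul (ContinuousOn.inv₀ (by fun_prop) hne) continuousOn_const
  · have h : ((1 - z : ℝ) : ℂ) - 1 = -z := by push_cast; ring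
    rw [h, inv_neg]
    module

theorem existsUnique_isPsi2 : ∃! Ψ : NCSeries Psi2Var, IsPsi2 Ψ := by
  have hA := isLinear_var Psi2Var.A
  have h0 := isLinear_var Psi2Var.b₀
  have h1 := isLinear_var Psi2Var.b₁
  -- The poles to be avoided: ±1 for `R` in the coordinate z, and 1, 2 (that is, z = 0, -1) for `S`
  -- in the coordinate 1 - z.
  have hne : ∀ c : ℝ, (c = 1 ∨ c = -1 ∨ c = 2) →
      ∀ t ∈ Set.Ioo (-1 : ℝ) 1, (t : ℂ) - (c : ℂ) ≠ 0 := fun c hc t ht h => by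
    have : t = c := by exact_mod_cast sub_eq_zero.1 h
    obtain ⟨ht1, ht2⟩ := ht
    rcases hc with rfl | rfl | rfl <;> linarith
  refine existsUnique_isRenormalizedHolonomy
    (R := fun t => ((t : ℂ) - (1 : ℝ))⁻¹ • var Psi2Var.b₀ +
      ((t : ℂ) - (-1 : ℝ))⁻¹ • var Psi2Var.b₁)
    (S := fun t => ((t : ℂ) - (1 : ℝ))⁻¹ • var Psi2Var.A +
      ((t : ℂ) - (2 : ℝ))⁻¹ • var Psi2Var.b₁)
    hA h0 (fun t => (h0.smul _).add (h1.smul _)) (fun t => (hA.smul _).add (h1.smul _))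
    (fun x => ?_) (fun x => ?_) (fun z => ?_) (fun z => ?_)
  · simp only [coeff_add, coeff_smul]
    exact ((ContinuousOn.inv₀ (by fun_prop) (hne 1 (by simp))).mul continuousOn_const).add
      ((ContinuousOn.inv₀ (by fun_prop) (hne (-1) (by simp))).mul continuousOn_const)
  · simp only [coeff_add, coeff_smul]
    exact ((ContinuousOn.inv₀ (by fun_prop) (hne 1 (by simp))).mul continuousOn_const).add
      ((ContinuousOn.inv₀ (by fun_prop) (hne 2 (by simp))).mul continuousOn_const)
  · simp [add_assoc]
  · have e1 : ((1 - z : ℝ) : ℂ) - (1 : ℝ) = -z := by push_cast; ring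
    have e2 : ((1 - z : ℝ) : ℂ) - (2 : ℝ) = -((z : ℂ) + 1) := by push_cast; ring
    rw [e1, e2, inv_neg, inv_neg]
    module

/-! ### The quadratic change of variable -/

instance : Fintype Psi2Var where
  elems := ⟨[Psi2Var.A, Psi2Var.b₀, Psi2Var.b₁], by simp⟩
  complete x := by cases x <;> simp

/-- The change of variable `u = 4 z / (1 + z)²`, a bijection of `(0,1)` onto itself. -/
noncomputable def quadraticMap (z : ℝ) : ℝ := 4 * z / (1 + z) ^ 2

/-- The double zero at z = 1 and the double pole at z = -1 account for the factors 2 and -2 in the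
substituted residues. -/
theorem one_sub_quadraticMap {z : ℝ} (hz : 0 < z) :
    1 - quadraticMap z = (1 - z) ^ 2 / (1 + z) ^ 2 := by
  rw [quadraticMap]
  field_simp
  ring

theorem quadraticMap_mem_Ioo {z : ℝ} (hz : z ∈ Set.Ioo (0 : ℝ) 1) :
    quadraticMap z ∈ Set.Ioo (0 : ℝ) 1 := by
  have h0 := hz.1
  have h1 : 0 < 1 - z := sub_pos.2 hz.2
  refine ⟨by rw [quadraticMap]; positivity, sub_pos.1 ?_⟩
  rw [one_sub_quadraticMap h0]
  positivity

theorem hasDerivAt_quadraticMap {z : ℝ} (hz : 0 < z) :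
    HasDerivAt quadraticMap (4 * (1 - z) / (1 + z) ^ 3) z := by
  have h := ((hasDerivAt_id' z).const_mul 4).fun_div (((hasDerivAt_id' z).const_add 1).fun_pow 2)
    (by positivity)
  refine h.congr_deriv ?_
  field_simp
  ring

theorem tendsto_quadraticMap_zero : Tendsto quadraticMap (𝓝[>] 0) (𝓝[>] 0) := by
  refine tendsto_nhdsWithin_iff.2 ⟨?_, ?_⟩
  · refine Tendsto.mono_left ?_ nhdsWithin_le_nhds
    have h : ContinuousAt quadraticMap 0 :=
      ContinuousAt.div (by fun_prop) (by fun_prop) (by norm_num)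
    simpa [quadraticMap] using h.tendsto
  · filter_upwards [Ioo_mem_nhdsGT zero_lt_one] with z hz
    exact (quadraticMap_mem_Ioo hz).1

theorem tendsto_quadraticMap_one : Tendsto quadraticMap (𝓝[<] 1) (𝓝[<] 1) := by
  refine tendsto_nhdsWithin_iff.2 ⟨?_, ?_⟩
  · refine Tendsto.mono_left ?_ nhdsWithin_le_nhds
    have h : ContinuousAt quadraticMap 1 :=
      ContinuousAt.div (by fun_prop) (by fun_prop) (by norm_num)
    have e : quadraticMap 1 = 1 := by norm_num [quadraticMap]
    simpa [e] using h.tendsto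
  · filter_upwards [Ioo_mem_nhdsLT zero_lt_one] with z hz
    exact (quadraticMap_mem_Ioo hz).2

theorem log_quadraticMap {z : ℝ} (hz : 0 < z) :
    Real.log (quadraticMap z) = Real.log 4 + Real.log z - 2 * Real.log (1 + z) := by
  rw [quadraticMap, Real.log_div (by positivity) (by positivity),
    Real.log_mul (by positivity) (by positivity), Real.log_pow]
  norm_num

theorem log_one_sub_quadraticMap {z : ℝ} (hz : z ∈ Set.Ioo (0 : ℝ) 1) :
    Real.log (1 - quadraticMap z) = 2 * Real.log (1 - z) - 2 * Real.log (1 + z) := by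
  have h0 := hz.1
  have h1 : 0 < 1 - z := sub_pos.2 hz.2
  rw [one_sub_quadraticMap h0, Real.log_div (by positivity) (by positivity), Real.log_pow,
    Real.log_pow]
  norm_num

/-- The pull-back of the KZ form under `u = 4 z / (1 + z)²`. -/
theorem quadraticMap_pullback {E : Type*} [AddCommGroup E] [Module ℂ E] (A B : E) {z : ℝ}
    (hz : z ∈ Set.Ioo (0 : ℝ) 1) :
    ((4 * (1 - z) / (1 + z) ^ 3 : ℝ) : ℂ) •
        ((quadraticMap z : ℂ)⁻¹ • A + ((quadraticMap z : ℂ) - 1)⁻¹ • B) =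
      (z : ℂ)⁻¹ • A + ((z : ℂ) - 1)⁻¹ • ((2 : ℂ) • B) +
        ((z : ℂ) + 1)⁻¹ • ((-2 : ℂ) • (A + B)) := by
  have h0 := hz.1
  have h1 : 0 < 1 - z := sub_pos.2 hz.2
  -- The common factor is u'(z). The coefficients of `A` and `B` are the logarithmic derivatives of
  -- z/(1+z)² and (1-z)²/(1+z)².
  have hA : 4 * (1 - z) / (1 + z) ^ 3 * (quadraticMap z)⁻¹ = z⁻¹ - 2 * (z + 1)⁻¹ := by
    rw [quadraticMap]
    field_simp
    ring
  have hB : 4 * (1 - z) / (1 + z) ^ 3 * (quadraticMap z - 1)⁻¹ =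
      2 * (z - 1)⁻¹ - 2 * (z + 1)⁻¹ := by
    rw [← neg_sub (1 : ℝ) (quadraticMap z), one_sub_quadraticMap h0, ← neg_sub (1 : ℝ) z]
    field_simp
    ring
  have hA' : ((4 * (1 - z) / (1 + z) ^ 3 : ℝ) : ℂ) * (quadraticMap z : ℂ)⁻¹ =
      (z : ℂ)⁻¹ - 2 * ((z : ℂ) + 1)⁻¹ := by exact_mod_cast congrArg Complex.ofReal hA
  have hB' : ((4 * (1 - z) / (1 + z) ^ 3 : ℝ) : ℂ) * ((quadraticMap z : ℂ) - 1)⁻¹ =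
      2 * ((z : ℂ) - 1)⁻¹ - 2 * ((z : ℂ) + 1)⁻¹ := by
    exact_mod_cast congrArg Complex.ofReal hB
  rw [smul_add, smul_smul, smul_smul, hA', hB']
  module

/-- This function is ln u - ln 4 - ln z, the exponent left over when u^A is compared with 4^A z^A.
-/
theorem tendsto_log_one_add_zero :
    Tendsto (fun z : ℝ => -2 * Real.log (1 + z)) (𝓝[>] 0) (𝓝 0) := by
  refine Tendsto.mono_left ?_ nhdsWithin_le_nhds
  have h : ContinuousAt (fun z : ℝ => -2 * Real.log (1 + z)) 0 :=
    continuousAt_const.mul (ContinuousAt.log (by fun_prop) (by norm_num))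
  simpa using h.tendsto

/-- This function is ln(1-u) + ln 4 - 2 ln(1-z), the exponent left over when (1-u)^B is compared
with 4^(-B) (1-z)^(2B). -/
theorem tendsto_log_one_add_one :
    Tendsto (fun z : ℝ => Real.log 4 - 2 * Real.log (1 + z)) (𝓝[<] 1) (𝓝 0) := by
  refine Tendsto.mono_left ?_ nhdsWithin_le_nhds
  have h : ContinuousAt (fun z : ℝ => Real.log 4 - 2 * Real.log (1 + z)) 1 :=
    continuousAt_const.sub (continuousAt_const.mul (ContinuousAt.log (by fun_prop) (by norm_num)))
  have e : Real.log 4 - 2 * Real.log (1 + 1) = 0 := by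
    rw [show (4 : ℝ) = (1 + 1) ^ 2 by norm_num, Real.log_pow]
    norm_num
  simpa only [ContinuousAt, e] using h

/-! ### Comparison of the normalised solutions -/

theorem kzAssociator_eq {Φ : NCSeries KZVar} {Ψ : NCSeries Psi2Var} (hΦ : IsKZAssociator Φ)
    (hΨ : IsPsi2 Ψ) :
    Φ = rpow 4 (var KZVar.B) *
      evalPsi2 Ψ (var KZVar.A) ((2 : ℂ) • var KZVar.B)
        ((-2 : ℂ) • (var KZVar.A + var KZVar.B)) * rpow 4 (var KZVar.A) := by
  obtain ⟨G₀, G₁, hG₀, hG₁, hG₀', hG₁', hΦ⟩ := hΦ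
  obtain ⟨H₀, H₁, hH₀, hH₁, hH₀', hH₁', hΨ⟩ := hΨ
  have hA := isLinear_var KZVar.A
  have hB := isLinear_var KZVar.B
  set A : NCSeries KZVar := var KZVar.A
  set B : NCSeries KZVar := var KZVar.B
  have hA0 := hA.coeff_nil
  have hB0 := hB.coeff_nil
  set s : Psi2Var → NCSeries KZVar := fun x => match x with
    | Psi2Var.A => A
    | Psi2Var.b₀ => (2 : ℂ) • B
    | Psi2Var.b₁ => (-2 : ℂ) • (A + B) with hsdef
  have hsΨ : evalPsi2 Ψ A ((2 : ℂ) • B) ((-2 : ℂ) • (A + B)) = subst s Ψ := rfl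
  have hs : ∀ x, IsLinear (s x) := by
    rintro (_ | _ | _)
    exacts [hA, hB.smul 2, (hA.add hB).smul (-2)]
  set Ω : ℝ → NCSeries KZVar := fun z => (z : ℂ)⁻¹ • A + ((z : ℂ) - 1)⁻¹ • ((2 : ℂ) • B) +
    ((z : ℂ) + 1)⁻¹ • ((-2 : ℂ) • (A + B))
  have hΩ0 : ∀ z ∈ Set.Ioo (0 : ℝ) 1, (Ω z).coeff [] = 0 := fun z _ =>
    (((hA.smul _).add ((hB.smul 2).smul _)).add (((hA.add hB).smul (-2)).smul _)).coeff_nil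
  have hH : ∀ H : ℝ → (NCSeries Psi2Var)ˣ, IsSolution
      (fun z : ℝ => ((z : ℂ)⁻¹) • var Psi2Var.A + (((z : ℂ) - 1)⁻¹) • var Psi2Var.b₀ +
        (((z : ℂ) + 1)⁻¹) • var Psi2Var.b₁) H →
      ∀ z ∈ Set.Ioo (0 : ℝ) 1, HasDeriv (fun t => subst s (H t)) (Ω z * subst s (H z)) z := by
    intro H h z hz
    refine ((h z hz).subst hs).congr_deriv ?_
    rw [subst_mul hs, subst_add hs, subst_add hs, subst_smul hs, subst_smul hs, subst_smul hs,
      subst_var hs, subst_var hs, subst_var hs]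
  -- A constant right factor preserves the equation; `K` will be the correction 4^(-A) at 0 and 4^B
  -- at 1.
  have hG : ∀ (G : ℝ → (NCSeries KZVar)ˣ) (K : NCSeries KZVar), IsSolution
      (fun u : ℝ => ((u : ℂ)⁻¹) • A + (((u : ℂ) - 1)⁻¹) • B) G →
      ∀ z ∈ Set.Ioo (0 : ℝ) 1, HasDeriv (fun t => (G (quadraticMap t) : NCSeries KZVar) * K)
        (Ω z * ((G (quadraticMap z) : NCSeries KZVar) * K)) z := by
    intro G K h z hz
    refine (((h _ (quadraticMap_mem_Ioo hz)).scomp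
      (hasDerivAt_quadraticMap hz.1)).mul_const K).congr_deriv ?_
    rw [← smul_mul_assoc, quadraticMap_pullback A B hz, mul_assoc]
  have hexp : ∀ (f : NCSeries KZVar), f.coeff [] = 0 → ∀ t : ℝ, IsUnit (exp ((t : ℂ) • f)) :=
    fun f hf t => isUnit_of_coeff_nil_ne_zero (by rw [exp_smul_coeff_nil hf]; exact one_ne_zero)
  have hc : (1 / 2 : ℝ) ∈ Set.Ioo (0 : ℝ) 1 := by constructor <;> norm_num
  have e₀ : subst s (H₀ (1 / 2)) =
      (G₀ (quadraticMap (1 / 2)) : NCSeries KZVar) * rpow 4 (-A) := by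
    refine eq_of_hasDeriv_of_tendsTo (r := fun z => rpow z (-A)) hΩ0 (hH H₀ hH₀)
      (hG G₀ (rpow 4 (-A)) hG₀) hc
      ((G₀ _).isUnit.mul (by rw [rpow_neg]; exact hexp A hA0 _)) (Ioo_mem_nhdsGT zero_lt_one)
      (fun z => by rw [rpow_neg, exp_smul_coeff_nil hA0]) ?_ ?_ _ hc
    · have h := hH₀'.subst hs
      simp only [subst_mul hs, subst_one hs, rpow_neg, subst_exp hs (coeff_var_nil _),
        subst_var hs] at h
      simp only [rpow_neg]
      exact h
    · have h := (hG₀'.comp tendsto_quadraticMap_zero).mul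
        (tendsTo_exp_smul hA0 tendsto_log_one_add_zero)
      rw [one_mul] at h
      refine h.congr' ?_
      filter_upwards [Ioo_mem_nhdsGT zero_lt_one] with z hz
      simp only [rpow_neg, mul_assoc, ← exp_add_smul hA0, log_quadraticMap hz.1]
      congr 4
      ring
  have e₁ : subst s (H₁ (1 / 2)) =
      (G₁ (quadraticMap (1 / 2)) : NCSeries KZVar) * rpow 4 B := by
    -- Since b₀ ↦ 2B, the normalising factor (1-z)^(-b₀) becomes exp(-2 ln(1-z) B).
    refine eq_of_hasDeriv_of_tendsTo (r := fun z => exp (((-(2 * Real.log (1 - z)) : ℝ) : ℂ) • B))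
      hΩ0 (hH H₁ hH₁) (hG G₁ (rpow 4 B) hG₁) hc
      ((G₁ _).isUnit.mul (hexp B hB0 _)) (Ioo_mem_nhdsLT zero_lt_one)
      (fun z => by rw [exp_smul_coeff_nil hB0]) ?_ ?_ _ hc
    · have h := hH₁'.subst hs
      simp only [subst_mul hs, subst_one hs, rpow_neg, subst_exp hs (coeff_var_nil _),
        subst_var hs] at h
      refine h.congr' (Eventually.of_forall fun z => ?_)
      simp only [hsdef, smul_smul]
      congr 3
      push_cast
      ring
    · have h := (hG₁'.comp tendsto_quadraticMap_one).mul
        (tendsTo_exp_smul hB0 tendsto_log_one_add_one)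
      rw [one_mul] at h
      refine h.congr' ?_
      filter_upwards [Ioo_mem_nhdsLT zero_lt_one] with z hz
      simp only [rpow_neg]
      simp only [rpow, mul_assoc, ← exp_add_smul hB0, log_one_sub_quadraticMap hz]
      congr 4
      ring
  -- Substituting in H₁ Ψ = H₀ rather than in Ψ = H₁⁻¹ H₀ avoids substituting in an inverse.
  have hΨ' : (H₁ (1 / 2) : NCSeries Psi2Var) * Ψ = H₀ (1 / 2) := by
    rw [hΨ _ hc, ← mul_assoc, Units.mul_inv, one_mul]
  have hS := subst_mul hs (H₁ (1 / 2) : NCSeries Psi2Var) Ψ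
  rw [hΨ', e₀, e₁] at hS
  have h4 : rpow 4 (-A) * rpow 4 A = 1 := by
    simpa using rpow_mul_rpow_neg (f := -A) (by rw [coeff_neg, hA0, neg_zero]) 4
  rw [hsΨ, hΦ _ (quadraticMap_mem_Ioo hc), Units.inv_mul_eq_iff_eq_mul, ← mul_assoc, ← mul_assoc, ← hS,
    mul_assoc, h4, mul_one]

theorem mainTheorem3 :
    (∃! Φ : NCSeries KZVar, IsKZAssociator Φ) ∧
    (∃! Ψ : NCSeries Psi2Var, IsPsi2 Ψ) ∧
    ∀ (Φ : NCSeries KZVar) (Ψ : NCSeries Psi2Var), IsKZAssociator Φ → IsPsi2 Ψ →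
      Φ = NCSeries.rpow 4 (NCSeries.var KZVar.B) *
          evalPsi2 Ψ (NCSeries.var KZVar.A)
            ((2 : ℂ) • NCSeries.var KZVar.B)
            ((-2 : ℂ) • (NCSeries.var KZVar.A + NCSeries.var KZVar.B)) *
          NCSeries.rpow 4 (NCSeries.var KZVar.A) :=
  ⟨existsUnique_isKZAssociator, existsUnique_isPsi2, fun _ _ => kzAssociator_eq⟩
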